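/- Let $\mathcal X,\mathcal Y,\mathcal Z$ be finite sets, let $f\colon\mathcal X\times\mathcal Y\to\mathcal Z$ be a function, let $\mu$ be a probability distribution on $\mathcal X\times\mathcal Y$, and let $\epsilon\ge 0$. Consider two-party communication protocols $\pi$ in which Alice has an input $x\in\mathcal X$ and Bob an input $y\in\mathcal Y$; they share a public random string, each has a private random string, and these random strings are independent with arbitrary distributions. Given the public random string the players follow a finite binary protocol tree: the bits sent so far determine whether the communication is over and, if not, who speaks; each bit sent is determined by the bits sent so far and by the speaker's input and private random string; each leaf carries an output in $\mathcal Z$ on which both players agree. Write $\pi(x,y)$ for the (random) output on input $(x,y)$. The transcript $\Pi$ consists of the public random string and all transmitted bits. For inputs $(X,Y)\sim\mu$ independent of the random strings, the information cost of $\pi$ is $$\mathrm{IC}_\mu(\pi)=I(\Pi;X\mid Y)+I(\Pi;Y\mid X),$$ where information is measured in bits. For $\delta\ge 0$ let $$\mathrm{IC}_\mu(f,\delta)=\inf\bigl\{\mathrm{IC}_\mu(\pi) : \Pr[\pi(x,y)\ne f(x,y)]\le\delta \text{ for every } (x,y)\in\mathcal X\times\mathcal Y\bigr\},$$ and let $h(p)=-p\log_2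 p-(1-p)\log_2(1-p)$, with $0\log_2 0=0$, be the binary entropy. Then $\mathrm{IC}_\mu(f,\epsilon)$ and $\mathrm{IC}_\mu(f,0)$ are finite, and $$\mathrm{IC}_\mu(f,\epsilon)\;\ge\;\mathrm{IC}_\mu(f,0)-4\,|\mathcal X|\,|\mathcal Y|\;h\bigl(\min(\sqrt{\epsilon},\,1/2)\bigr).$$ -/

import Mathlib

open MeasureTheory ProbabilityTheory
open scoped ENNReal

namespace InfoComplexity

universe u v w

/-- Bit strings carry the discrete σ-algebra. -/
instance : MeasurableSpace (List Bool) := ⊤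

instance : DiscreteMeasurableSpace (List Bool) := ⟨fun _ => trivial⟩

/-- A deterministic two-party communication protocol as a finite binary tree. `A` is what Alice
knows privately and `B` is what Bob knows privately. At an `alice` node Alice sends the bit `bit a`,
at a `bob` node Bob sends the bit `bit b`, and the bit sent selects the subtree in which the
conversation goes on. At a leaf both players agree on the output written there. -/
inductive ProtocolTree (A : Type u) (B : Type v) (Z : Type w) : Type (max u v w)
  | leaf (output : Z) : ProtocolTree A B Z
  | alice (bit : A → Bool) (next : Bool → ProtocolTree A B Z) : ProtocolTree A B Z
  | bob (bit : B → Bool) (next : Bool → ProtocolTree A B Z) : ProtocolTree A B Z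

namespace ProtocolTree

variable {A : Type u} {B : Type v} {Z : Type w}

/-- The list of the transmitted bits. -/
def bits : ProtocolTree A B Z → A → B → List Bool
  | leaf _, _, _ => []
  | alice bit next, a, b => bit a :: (next (bit a)).bits a b
  | bob bit next, a, b => bit b :: (next (bit b)).bits a b

/-- The value on which the players agree at the end. -/
def output : ProtocolTree A B Z → A → B → Z
  | leaf z, _, _ => z
  | alice bit next, a, b => (next (bit a)).output a b
  | bob bit next, a, b => (next (bit b)).output a b

end ProtocolTree

/-- A randomized two-party protocol. The public randomness (with values in `R`) and the private
randomness of Alice and Bob (with values in `RA` and `RB`) are independent and have arbitrary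
distributions. Given the public randomness `r`, the players follow the tree `tree r`, in which
Alice's bits depend on her input and her private randomness only, and Bob's bits on his input and
his private randomness only. -/
structure Protocol (X : Type u) (Y : Type v) (Z : Type w) where
  R : Type
  RA : Type
  RB : Type
  [msR : MeasurableSpace R]
  [msRA : MeasurableSpace RA]
  [msRB : MeasurableSpace RB]
  distR : Measure R
  distRA : Measure RA
  distRB : Measure RB
  [probR : IsProbabilityMeasure distR]
  [probRA : IsProbabilityMeasure distRA]
  [probRB : IsProbabilityMeasure distRB]
  tree : R → ProtocolTree (X × RA) (Y × RB) Z
  measurable_bits : ∀ (x : X) (y : Y),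
    Measurable fun ω : R × RA × RB => (tree ω.1).bits (x, ω.2.1) (y, ω.2.2)
  measurable_output : ∀ (x : X) (y : Y) (z : Z),
    MeasurableSet {ω : R × RA × RB | (tree ω.1).output (x, ω.2.1) (y, ω.2.2) = z}

attribute [instance] Protocol.msR Protocol.msRA Protocol.msRB
  Protocol.probR Protocol.probRA Protocol.probRB

/-- The conditional mutual information `I(T ; S | W)` in bits, for a random variable `W` with
finitely many values: the average over the values `w` of `W` of the Kullback-Leibler divergence
between the joint law of `(T, S)` given `W = w` and the product of the laws of `T` and `S` given
`W = w`. (Division by `log 2` passes from nats to bits.) -/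
noncomputable def condMutualInfo {Ω : Type*} {α : Type*} {β : Type*} {γ : Type*}
    [MeasurableSpace Ω] [MeasurableSpace α] [MeasurableSpace β] [Fintype γ]
    (P : Measure Ω) (T : Ω → α) (S : Ω → β) (W : Ω → γ) : ℝ≥0∞ :=
  (∑ w : γ, P (W ⁻¹' {w}) *
    InformationTheory.klDiv ((P[|W ⁻¹' {w}]).map fun ω => (T ω, S ω))
      (((P[|W ⁻¹' {w}]).map T).prod ((P[|W ⁻¹' {w}]).map S))) / ENNReal.ofReal (Real.log 2)

namespace Protocol

variable {X : Type u} {Y : Type v} {Z : Type w}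

/-- The joint law of the public and of the two private random strings. -/
noncomputable def coins (π : Protocol X Y Z) : Measure (π.R × π.RA × π.RB) :=
  π.distR.prod (π.distRA.prod π.distRB)

/-- The output `π(x, y)`, as a function of the random strings. -/
def output (π : Protocol X Y Z) (x : X) (y : Y) (ω : π.R × π.RA × π.RB) : Z :=
  (π.tree ω.1).output (x, ω.2.1) (y, ω.2.2)

/-- The transcript: the public random string together with the transmitted bits. -/
def transcript (π : Protocol X Y Z) (x : X) (y : Y) (ω : π.R × π.RA × π.RB) : π.R × List Bool :=
  (ω.1, (π.tree ω.1).bits (x, ω.2.1) (y, ω.2.2))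

/-- `π` performs the task `[f, ε]`: on every input it errs with probability at most `ε`. -/
def Performs (π : Protocol X Y Z) (f : X → Y → Z) (ε : ℝ) : Prop :=
  ∀ (x : X) (y : Y), π.coins.real {ω | π.output x y ω ≠ f x y} ≤ ε

/-- The internal information cost `I(Π ; X | Y) + I(Π ; Y | X)` of `π`, where the inputs `(X, Y)`
have law `μ` and are independent of the random strings. -/
noncomputable def infoCost [Fintype X] [Fintype Y] [MeasurableSpace X] [MeasurableSpace Y]
    (π : Protocol X Y Z) (μ : Measure (X × Y)) : ℝ≥0∞ :=
  condMutualInfo (μ.prod π.coins) (fun ω => π.transcript ω.1.1 ω.1.2 ω.2)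
      (fun ω => ω.1.1) (fun ω => ω.1.2) +
    condMutualInfo (μ.prod π.coins) (fun ω => π.transcript ω.1.1 ω.1.2 ω.2)
      (fun ω => ω.1.2) (fun ω => ω.1.1)

end Protocol

/-- The information complexity `IC_μ(f, ε)`: the infimum of the information costs of the protocols
that perform `[f, ε]`. -/
noncomputable def IC {X : Type u} {Y : Type v} {Z : Type w} [Fintype X] [Fintype Y]
    [MeasurableSpace X] [MeasurableSpace Y]
    (μ : Measure (X × Y)) (f : X → Y → Z) (ε : ℝ) : ℝ≥0∞ :=
  ⨅ (π : Protocol X Y Z) (_ : π.Performs f ε), π.infoCost μ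

/-- The binary entropy in bits. -/
noncomputable def h (p : ℝ) : ℝ := Real.binEntropy p / Real.log 2

end InfoComplexity

/-! Errors are repaired one input pair at a time. To repair `(a, b)`, the players run the given
protocol and, if the transcript announces an output other than `f a b`, check whether the inputs are
`(a, b)`; if so they output `f a b`. The player less likely to say yes, given the transcript, speaks
first, and the other answers only after a yes. No other output changes, so no error probability
grows (`exists_protocol_correct_at`).

The first yes is rare. Let `A` and `B` be the transcript densities on the events `X = a` and `Y =
b`. The first yes has probability `∫ min(A, B)` over the wrong transcripts. By the rectangle
property `A * B = P * C`, where `P` is the density on input `(a, b)` and `C` has mass at most 1. By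
AM-GM, `2 s min(A, B) ≤ P + s² C`; with `s = √ε` the right side integrates to at most `2 s²`, so the
probability is at most `√ε` (`prod_coins_check_le`).

The check is therefore cheap. For someone who knows one input and the old transcript, the new bits
amount to a single bit that is true with probability at most `s`. It adds at most `h s` to each of
the two information terms (`condMutualInfo_extend_le`), by comparison with a Bernoulli reference.
Repairing all pairs costs at most `2 |X| |Y| h s`, half of what is claimed. Starting from a constant
protocol, the same bound gives finiteness. -/

namespace InfoComplexity

open InformationTheory

universe u v w

/-! ### Information cost of one additional bit -/

/-- Among all product references `σ × ν` the marginal `σ = ρ.fst` minimizes the divergence. -/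
theorem klDiv_fst_prod_le {α β : Type*} [MeasurableSpace α] [MeasurableSpace β]
    [StandardBorelSpace β] [Nonempty β] (ρ : Measure (α × β)) [IsFiniteMeasure ρ]
    (σ : Measure α) [IsFiniteMeasure σ] (ν : Measure β) [IsProbabilityMeasure ν] :
    klDiv ρ (ρ.fst.prod ν) ≤ klDiv ρ (σ.prod ν) := by
  have hρ : ρ.fst ⊗ₘ ρ.condKernel = ρ := ρ.disintegrate ρ.condKernel
  -- Chain rule with `ν` as a constant kernel: the two divergences differ by `klDiv ρ.fst σ`, which
  -- is nonnegative.
  have key := klDiv_compProd_eq_add ρ.fst σ ρ.condKernel (Kernel.const α ν)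
  rw [hρ, Measure.compProd_const, Measure.compProd_const] at key
  rw [key]
  exact le_add_self

/-- The divergence of the graph of a boolean function from a product with a measure on `Bool`. -/
theorem klDiv_graph_prod_le {α : Type*} [MeasurableSpace α] (ρ : Measure α)
    [IsProbabilityMeasure ρ] (φ : α → Bool) (hφ : Measurable φ) (Q : Measure Bool)
    [IsProbabilityMeasure Q] (hQ : ∀ c, Q {c} ≠ 0) :
    klDiv (ρ.map fun x => (x, φ x)) (ρ.prod Q) ≤
      ∑ c : Bool, ρ (φ ⁻¹' {c}) * ENNReal.ofReal (-Real.log (Q {c}).toReal) := by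
  -- The density of the graph law relative to `ρ.prod Q`: on the graph it is the inverse mass of the
  -- bit, so the log-likelihood ratio is `-log Q {φ x}`.
  set g : α × Bool → ℝ≥0∞ := fun p => if φ p.1 = p.2 then (Q {p.2})⁻¹ else 0 with hg
  have hgm : Measurable g := by
    refine measurable_from_prod_countable_left fun c => ?_
    exact Measurable.ite (hφ (measurableSet_singleton c)) (measurable_const (a := (Q {c})⁻¹))
      measurable_const
  have hgr : Measurable fun x => (x, φ x) := measurable_id.prodMk hφ
  have hwd : ρ.map (fun x => (x, φ x)) = (ρ.prod Q).withDensity g := by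
    refine Measure.ext fun s hs => ?_
    rw [Measure.map_apply hgr hs, withDensity_apply _ hs, ← lintegral_indicator hs,
      lintegral_prod _ (hgm.indicator hs).aemeasurable, ← lintegral_indicator_one (hgr hs)]
    refine lintegral_congr fun x => ?_
    rw [lintegral_fintype]
    by_cases hx : (x, φ x) ∈ s
    · rw [Finset.sum_eq_single (φ x)]
      · have : x ∈ (fun x => (x, φ x)) ⁻¹' s := hx
        simp [Set.indicator_of_mem this, Set.indicator_of_mem hx, hg,
          ENNReal.inv_mul_cancel (hQ _) (measure_ne_top _ _)]
      · intro c _ hc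
        have : φ x ≠ c := fun h => hc h.symm
        simp [Set.indicator, hg, this]
      · simp
    · have : x ∉ (fun x => (x, φ x)) ⁻¹' s := hx
      rw [Set.indicator_of_notMem this, Finset.sum_eq_zero]
      intro c _
      by_cases hc : φ x = c
      · subst hc; simp [Set.indicator_of_notMem hx]
      · simp [Set.indicator, hg, hc]
  have : IsProbabilityMeasure (ρ.map fun x => (x, φ x)) :=
    Measure.isProbabilityMeasure_map hgr.aemeasurable
  have hac : ρ.map (fun x => (x, φ x)) ≪ ρ.prod Q := by
    rw [hwd]; exact withDensity_absolutelyContinuous _ _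
  have hrn : (ρ.map fun x => (x, φ x)).rnDeriv (ρ.prod Q) =ᵐ[ρ.prod Q] g := by
    rw [hwd]; exact Measure.rnDeriv_withDensity _ hgm
  set L : Bool → ℝ := fun c => -Real.log (Q {c}).toReal with hL
  have hLn : ∀ c, 0 ≤ L c := fun c => by
    have : (Q {c}).toReal ≤ 1 := ENNReal.toReal_mono ENNReal.one_ne_top prob_le_one
    have := Real.log_nonpos ENNReal.toReal_nonneg this
    simp only [hL]; linarith
  have hllr : llr (ρ.map fun x => (x, φ x)) (ρ.prod Q) =ᵐ[ρ.map fun x => (x, φ x)]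
      fun p => L p.2 := by
    have h2 : ∀ᵐ p ∂(ρ.map fun x => (x, φ x)), φ p.1 = p.2 := by
      rw [ae_map_iff hgr.aemeasurable]
      · simp
      · exact measurableSet_eq_fun (hφ.comp measurable_fst) measurable_snd
    filter_upwards [hac.ae_le hrn, h2] with p hp hp2
    simp [llr, hp, hg, hp2, hL, Real.log_inv]
  have hLm : Measurable fun p : α × Bool => L p.2 := (measurable_of_finite L).comp measurable_snd
  have hint : Integrable (fun p : α × Bool => L p.2) (ρ.map fun x => (x, φ x)) := by
    refine Integrable.of_bound hLm.aestronglyMeasurable (∑ c, ‖L c‖) ?_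
    exact .of_forall fun p => Finset.single_le_sum (f := fun c => ‖L c‖)
      (fun c _ => norm_nonneg _) (Finset.mem_univ p.2)
  rw [klDiv_of_ac_of_integrable hac (hint.congr hllr.symm), integral_congr_ae hllr]
  simp only [probReal_univ, add_sub_cancel_right]
  rw [ofReal_integral_eq_lintegral_ofReal hint (.of_forall fun p => hLn p.2),
    lintegral_map hLm.ennreal_ofReal hgr]
  have : ∀ x, ENNReal.ofReal (L (φ x)) =
      ∑ c : Bool, (φ ⁻¹' {c}).indicator (fun _ => ENNReal.ofReal (L c)) x := by
    intro x
    rw [Finset.sum_eq_single (φ x)]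
    · simp
    · intro c _ hc
      have : φ x ≠ c := fun h => hc h.symm
      simp [Set.indicator, this]
    · simp
  simp only [this]
  rw [lintegral_finsetSum _ fun c _ => measurable_const.indicator (hφ (measurableSet_singleton c))]
  refine Finset.sum_le_sum fun c _ => ?_
  rw [lintegral_indicator_const (hφ (measurableSet_singleton c)), mul_comm]

/-- Extending `T` by a boolean function of `(T, S)` raises the mutual information with `S` by at
most the cross entropy of that bit relative to any measure `Q` on `Bool`. -/
theorem klDiv_extend_le {Ω α α' β : Type*} [MeasurableSpace Ω] [MeasurableSpace α]
    [MeasurableSpace α'] [MeasurableSpace β] [StandardBorelSpace β] (P : Measure Ω)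
    [IsProbabilityMeasure P] {T : Ω → α} {T' : Ω → α'} {S : Ω → β} (hT : Measurable T)
    (hT' : Measurable T') (hS : Measurable S) {φ : α × β → Bool} (hφ : Measurable φ)
    {Ψ : α × Bool → α'} (hΨ : Measurable Ψ) (hTT' : ∀ᵐ ω ∂P, T' ω = Ψ (T ω, φ (T ω, S ω)))
    (Q : Measure Bool) [IsProbabilityMeasure Q] (hQ : ∀ c, Q {c} ≠ 0) :
    klDiv (P.map fun ω => (T' ω, S ω)) ((P.map T').prod (P.map S)) ≤
      klDiv (P.map fun ω => (T ω, S ω)) ((P.map T).prod (P.map S)) +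
        ∑ c : Bool, P ((fun ω => φ (T ω, S ω)) ⁻¹' {c}) *
          ENNReal.ofReal (-Real.log (Q {c}).toReal) := by
  have hTS : Measurable fun ω => (T ω, S ω) := hT.prodMk hS
  have hTS' : Measurable fun ω => (T' ω, S ω) := hT'.prodMk hS
  have : IsProbabilityMeasure (P.map T) := Measure.isProbabilityMeasure_map hT.aemeasurable
  have : IsProbabilityMeasure (P.map S) := Measure.isProbabilityMeasure_map hS.aemeasurable
  have : IsProbabilityMeasure (P.map fun ω => (T ω, S ω)) :=
    Measure.isProbabilityMeasure_map hTS.aemeasurable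
  have : IsProbabilityMeasure (P.map fun ω => (T' ω, S ω)) :=
    Measure.isProbabilityMeasure_map hTS'.aemeasurable
  have : Nonempty β := (P.nonempty_of_neZero).map S
  set ρ := P.map fun ω => (T ω, S ω) with hρ
  have hgr : Measurable fun p : α × β => (p, φ p) := measurable_id.prodMk hφ
  have : IsProbabilityMeasure (((P.map T).prod Q).map Ψ) :=
    Measure.isProbabilityMeasure_map hΨ.aemeasurable
  let m : (α × β) × Bool → α' × β := fun q => (Ψ (q.1.1, q.2), q.1.2)
  have hm : Measurable m := by fun_prop
  have e1 : P.map (fun ω => (T' ω, S ω)) = (ρ.map fun p => (p, φ p)).map m := by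
    rw [hρ, Measure.map_map hgr hTS, Measure.map_map hm (hgr.comp hTS)]
    refine Measure.map_congr ?_
    filter_upwards [hTT'] with ω hω
    simp [m, hω]
  have e2 : (((P.map T).prod Q).map Ψ).prod (P.map S) =
      (((P.map T).prod (P.map S)).prod Q).map m := by
    have hswap : Measurable fun q : (α × β) × Bool => ((q.1.1, q.2), q.1.2) := by fun_prop
    have : (((P.map T).prod (P.map S)).prod Q).map
        (fun q : (α × β) × Bool => ((q.1.1, q.2), q.1.2)) =
        ((P.map T).prod Q).prod (P.map S) := by
      have h1 : IsFiniteMeasure ((((P.map T).prod (P.map S)).prod Q).map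
          fun q : (α × β) × Bool => ((q.1.1, q.2), q.1.2)) := inferInstance
      rw [Measure.ext_prod₃_iff']
      intro s t u hs ht hu
      rw [Measure.map_apply hswap ((hs.prod ht).prod hu), Measure.prod_prod, Measure.prod_prod]
      have : (fun q : (α × β) × Bool => ((q.1.1, q.2), q.1.2)) ⁻¹' ((s ×ˢ t) ×ˢ u) =
          (s ×ˢ u) ×ˢ t := by
        ext q; simp only [Set.mem_preimage, Set.mem_prod]; tauto
      rw [this, Measure.prod_prod, Measure.prod_prod]
      ring
    have h2 := Measure.map_prod_map ((P.map T).prod Q) (P.map S) hΨ measurable_id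
    rw [Measure.map_id] at h2
    rw [h2, ← this, Measure.map_map (hΨ.prodMap measurable_id) hswap]
    rfl
  have hfst : (P.map fun ω => (T' ω, S ω)).fst = P.map T' := by
    rw [Measure.fst_map_prodMk hS]
  -- The law of `T'` is replaced by the law it would have if the new bit were drawn from `Q`
  -- independently of `T`. Data processing then removes `Ψ`, and the chain rule splits off the
  -- divergence of the bit.
  calc _ ≤ klDiv (P.map fun ω => (T' ω, S ω)) ((((P.map T).prod Q).map Ψ).prod (P.map S)) := by
        rw [← hfst]; exact klDiv_fst_prod_le _ _ _
    _ ≤ klDiv (ρ.map fun p => (p, φ p)) (((P.map T).prod (P.map S)).prod Q) := by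
        rw [e1, e2]; exact klDiv_map_le _ _ hm
    _ = klDiv ρ ((P.map T).prod (P.map S)) + klDiv (ρ.map fun p => (p, φ p)) (ρ.prod Q) := by
        have := klDiv_compProd_eq_add ρ ((P.map T).prod (P.map S)) (Kernel.deterministic φ hφ)
          (Kernel.const _ Q)
        rwa [Measure.compProd_const, Measure.compProd_const, Measure.compProd_deterministic] at this
    _ ≤ _ := by
        gcongr
        refine (klDiv_graph_prod_le ρ φ hφ Q hQ).trans_eq ?_
        refine Finset.sum_congr rfl fun c _ => ?_
        rw [hρ, Measure.map_apply hTS (hφ (measurableSet_singleton c))]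
        rfl

/-- The left side is affine in `p` with slope `log ((1 - s) / s) ≥ 0`, and equals the entropy at `p
= s`. At `s = 1 / 2` the slope vanishes, so no bound on `p` is needed. -/
theorem crossEntropy_le_binEntropy {p s : ℝ} (hs0 : 0 < s) (hs2 : s ≤ 1 / 2)
    (hp : p ≤ s ∨ s = 1 / 2) :
    p * -Real.log s + (1 - p) * -Real.log (1 - s) ≤ Real.binEntropy s := by
  rw [Real.binEntropy, Real.log_inv, Real.log_inv]
  have hlog : Real.log s ≤ Real.log (1 - s) := Real.log_le_log hs0 (by linarith)
  rcases hp with hp | rfl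
  · nlinarith
  · norm_num
    linarith

/-- Extending `T` by a bit that is a function of `(T, S, W)` and equals `true` with probability at
most `s` raises the conditional mutual information with `S` given `W` by at most `h s`. -/
theorem condMutualInfo_extend_le {Ω α α' β γ : Type*} [MeasurableSpace Ω] [MeasurableSpace α]
    [MeasurableSpace α'] [MeasurableSpace β] [StandardBorelSpace β] [Fintype γ]
    [MeasurableSpace γ] [MeasurableSingletonClass γ] (P : Measure Ω)
    [IsProbabilityMeasure P] {T : Ω → α} {T' : Ω → α'} {S : Ω → β} {W : Ω → γ} (hT : Measurable T)
    (hT' : Measurable T') (hS : Measurable S) (hW : Measurable W) {φ : γ → α × β → Bool}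
    (hφ : ∀ w, Measurable (φ w)) {Ψ : γ → α × Bool → α'} (hΨ : ∀ w, Measurable (Ψ w))
    (hTT' : ∀ ω, T' ω = Ψ (W ω) (T ω, φ (W ω) (T ω, S ω))) {s : ℝ} (hs0 : 0 < s) (hs2 : s ≤ 1 / 2)
    (hp : P {ω | φ (W ω) (T ω, S ω) = true} ≤ ENNReal.ofReal s ∨ s = 1 / 2) :
    condMutualInfo P T' S W ≤ condMutualInfo P T S W + ENNReal.ofReal (h s) := by
  -- One Bernoulli reference serves all values `w`. The costs are then linear in the conditional
  -- probabilities of the bit and average to the cost of its overall probability, without any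
  -- concavity argument.
  set Q : Measure Bool := ENNReal.ofReal s • Measure.dirac true +
    ENNReal.ofReal (1 - s) • Measure.dirac false with hQdef
  have hQt : Q {true} = ENNReal.ofReal s := by simp [hQdef]
  have hQf : Q {false} = ENNReal.ofReal (1 - s) := by simp [hQdef]
  have hQp : IsProbabilityMeasure Q := ⟨by
    simp [hQdef, ← ENNReal.ofReal_add hs0.le (by linarith : (0 : ℝ) ≤ 1 - s)]⟩
  have hQ : ∀ c, Q {c} ≠ 0 := by
    rintro (_ | _)
    · rw [hQf]; simp; linarith
    · rw [hQt]; simp [hs0]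
  set L : Bool → ℝ≥0∞ := fun c => ENNReal.ofReal (-Real.log (Q {c}).toReal) with hL
  set F : Ω → Bool := fun ω => φ (W ω) (T ω, S ω) with hF
  have hWm : ∀ w, MeasurableSet (W ⁻¹' {w}) := fun w => hW (measurableSet_singleton w)
  have hFm : Measurable F := by
    have : Measurable fun p : (α × β) × γ => φ p.2 p.1 :=
      measurable_from_prod_countable_left fun w => hφ w
    exact this.comp ((hT.prodMk hS).prodMk hW)
  have hstep : ∀ w, P (W ⁻¹' {w}) * klDiv ((P[|W ⁻¹' {w}]).map fun ω => (T' ω, S ω))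
      (((P[|W ⁻¹' {w}]).map T').prod ((P[|W ⁻¹' {w}]).map S)) ≤
      P (W ⁻¹' {w}) * klDiv ((P[|W ⁻¹' {w}]).map fun ω => (T ω, S ω))
      (((P[|W ⁻¹' {w}]).map T).prod ((P[|W ⁻¹' {w}]).map S)) +
      ∑ c, P (W ⁻¹' {w} ∩ F ⁻¹' {c}) * L c := by
    intro w
    by_cases hw : P (W ⁻¹' {w}) = 0
    · simp [hw]
    have := cond_isProbabilityMeasure hw
    have hae : ∀ᵐ ω ∂P[|W ⁻¹' {w}], W ω = w := by
      exact ae_cond_mem (hWm w)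
    have key := klDiv_extend_le (P[|W ⁻¹' {w}]) hT hT' hS (hφ w) (hΨ w)
      (by filter_upwards [hae] with ω hω; rw [hTT', hω]) Q hQ
    refine (mul_le_mul_right key (P (W ⁻¹' {w}))).trans_eq ?_
    rw [mul_add, Finset.mul_sum]
    congr 1
    refine Finset.sum_congr rfl fun c _ => ?_
    rw [← mul_assoc]
    congr 1
    have e : P[|W ⁻¹' {w}] ((fun ω => φ w (T ω, S ω)) ⁻¹' {c}) =
        P[|W ⁻¹' {w}] (F ⁻¹' {c}) := by
      refine measure_congr ?_
      filter_upwards [hae] with ω hω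
      change (φ w (T ω, S ω) = c) = (φ (W ω) (T ω, S ω) = c)
      rw [hω]
    rw [e, mul_comm, cond_mul_eq_inter (hWm w)]
  have hsum : ∑ w, ∑ c, P (W ⁻¹' {w} ∩ F ⁻¹' {c}) * L c = ∑ c, P (F ⁻¹' {c}) * L c := by
    rw [Finset.sum_comm]
    refine Finset.sum_congr rfl fun c _ => ?_
    rw [← Finset.sum_mul]
    congr 1
    rw [← measure_biUnion_finset]
    · congr 1; ext ω; simp
    · intro w _ w' _ hww
      refine Set.disjoint_left.2 fun ω h1 h2 => hww ?_
      exact (h1.1 : W ω = w).symm.trans h2.1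
    · exact fun w _ => (hWm w).inter (hFm (measurableSet_singleton c))
  have hcost : ∑ c, P (F ⁻¹' {c}) * L c ≤ ENNReal.ofReal (Real.binEntropy s) := by
    have ht : P (F ⁻¹' {true}) = ENNReal.ofReal (P.real (F ⁻¹' {true})) := by simp
    have hf : P (F ⁻¹' {false}) = ENNReal.ofReal (1 - P.real (F ⁻¹' {true})) := by
      rw [← probReal_compl_eq_one_sub (hFm (measurableSet_singleton _)), ofReal_measureReal]
      congr 1; ext ω; simp
    have hp1 : P.real (F ⁻¹' {true}) ≤ 1 := measureReal_le_one
    have l1 : 0 ≤ -Real.log s := by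
      have := Real.log_nonpos hs0.le (by linarith); linarith
    have l2 : 0 ≤ -Real.log (1 - s) := by
      have := Real.log_nonpos (x := 1 - s) (by linarith) (by linarith); linarith
    simp only [Fintype.sum_bool, hL]
    rw [hQt, hQf, ENNReal.toReal_ofReal hs0.le,
      ENNReal.toReal_ofReal (by linarith), ht, hf, ← ENNReal.ofReal_mul measureReal_nonneg,
      ← ENNReal.ofReal_mul (by linarith), ← ENNReal.ofReal_add (by positivity)
        (mul_nonneg (by linarith) l2)]
    refine ENNReal.ofReal_le_ofReal (crossEntropy_le_binEntropy hs0 hs2 (hp.imp_left fun hp => ?_))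
    exact ENNReal.toReal_le_of_le_ofReal hs0.le hp
  have hlog2 : 0 < Real.log 2 := Real.log_pos one_lt_two
  rw [condMutualInfo, condMutualInfo, h, ENNReal.ofReal_div_of_pos hlog2, ← ENNReal.add_div]
  gcongr
  refine (Finset.sum_le_sum fun w _ => hstep w).trans ?_
  rw [Finset.sum_add_distrib, hsum]
  gcongr

/-- A constant carries no information. -/
theorem condMutualInfo_const {Ω α β γ : Type*} [MeasurableSpace Ω] [MeasurableSpace α]
    [MeasurableSpace β] [Fintype γ] (P : Measure Ω) [IsProbabilityMeasure P] (t : α) {S : Ω → β}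
    {W : Ω → γ} (hS : Measurable S) : condMutualInfo P (fun _ => t) S W = 0 := by
  rw [condMutualInfo, Finset.sum_eq_zero, ENNReal.zero_div]
  intro w _
  by_cases hw : P (W ⁻¹' {w}) = 0
  · simp [hw]
  have := cond_isProbabilityMeasure hw
  have heq : ((P[|W ⁻¹' {w}]).map fun _ => t).prod ((P[|W ⁻¹' {w}]).map S) =
      (P[|W ⁻¹' {w}]).map fun ω => (t, S ω) := by
    rw [Measure.map_const, measure_univ, one_smul, Measure.dirac_prod,
      Measure.map_map measurable_prodMk_left hS]
    rfl
  have := Measure.isProbabilityMeasure_map (μ := P[|W ⁻¹' {w}])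
    (measurable_const (a := t).prodMk hS).aemeasurable
  rw [heq, klDiv_self, mul_zero]

/-! ### Protocol trees: extension, rectangles, the check -/

namespace ProtocolTree

variable {A : Type u} {B : Type v} {Z : Type w}

/-- Replace every leaf by a tree that depends on the bits sent so far and on the output. -/
def extend : ProtocolTree A B Z → (List Bool → Z → ProtocolTree A B Z) → ProtocolTree A B Z
  | leaf z, k => k [] z
  | alice bit next, k => alice bit fun c => (next c).extend fun t => k (c :: t)
  | bob bit next, k => bob bit fun c => (next c).extend fun t => k (c :: t)

theorem bits_extend (T : ProtocolTree A B Z) (k : List Bool → Z → ProtocolTree A B Z)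
    (a : A) (b : B) :
    (T.extend k).bits a b = T.bits a b ++ (k (T.bits a b) (T.output a b)).bits a b := by
  induction T generalizing k with
  | leaf z => simp [extend, bits, output]
  | alice bit next ih => simp [extend, bits, output, ih]
  | bob bit next ih => simp [extend, bits, output, ih]

theorem output_extend (T : ProtocolTree A B Z) (k : List Bool → Z → ProtocolTree A B Z)
    (a : A) (b : B) :
    (T.extend k).output a b = (k (T.bits a b) (T.output a b)).output a b := by
  induction T generalizing k with
  | leaf z => simp [extend, bits, output]
  | alice bit next ih => simp [extend, bits, output, ih]
  | bob bit next ih => simp [extend, bits, output, ih]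

/-- Alice's bits along the path `t`, which ends at a leaf, are those that she sends given `a`. -/
def AliceAgrees : ProtocolTree A B Z → List Bool → A → Prop
  | leaf _, t, _ => t = []
  | alice _ _, [], _ => False
  | alice bit next, c :: t, a => bit a = c ∧ (next c).AliceAgrees t a
  | bob _ _, [], _ => False
  | bob _ next, c :: t, a => (next c).AliceAgrees t a

/-- Bob's bits along the path `t`, which ends at a leaf, are those that he sends given `b`. -/
def BobAgrees : ProtocolTree A B Z → List Bool → B → Prop
  | leaf _, t, _ => t = []
  | alice _ _, [], _ => False
  | alice _ next, c :: t, b => (next c).BobAgrees t b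
  | bob _ _, [], _ => False
  | bob bit next, c :: t, b => bit b = c ∧ (next c).BobAgrees t b

/-- The rectangle property of transcripts. -/
theorem bits_eq_iff (T : ProtocolTree A B Z) (t : List Bool) (a : A) (b : B) :
    T.bits a b = t ↔ T.AliceAgrees t a ∧ T.BobAgrees t b := by
  induction T generalizing t with
  | leaf z => simp [bits, AliceAgrees, BobAgrees, eq_comm]
  | alice bit next ih =>
    cases t with
    | nil => simp [bits, AliceAgrees]
    | cons c t =>
      simp only [bits, AliceAgrees, BobAgrees, List.cons.injEq, ih]
      grind
  | bob bit next ih =>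
    cases t with
    | nil => simp [bits, AliceAgrees]
    | cons c t =>
      simp only [bits, AliceAgrees, BobAgrees, List.cons.injEq, ih]
      grind

/-- This makes an error visible in the transcript, so that both players know when to start the
check. -/
theorem output_eq_of_bits_eq (T : ProtocolTree A B Z) {a a' : A} {b b' : B}
    (hbits : T.bits a b = T.bits a' b') : T.output a b = T.output a' b' := by
  induction T with
  | leaf z => rfl
  | alice bit next ih =>
    simp only [bits, List.cons.injEq] at hbits
    obtain ⟨h1, h2⟩ := hbits
    simp only [output]
    rw [← h1] at h2 ⊢
    exact ih _ h2
  | bob bit next ih =>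
    simp only [bits, List.cons.injEq] at hbits
    obtain ⟨h1, h2⟩ := hbits
    simp only [output]
    rw [← h1] at h2 ⊢
    exact ih _ h2

/-- The players find out whether both `p` and `q` hold. One of them announces her or his bit, and
the other one answers if it is `true`. The output is `z'` if both hold, and `z` otherwise. -/
def check (p : A → Bool) (q : B → Bool) (z' z : Z) : Bool → ProtocolTree A B Z
  | true => alice p fun c => bif c then bob q fun d => leaf (bif d then z' else z) else leaf z
  | false => bob q fun d => bif d then alice p fun c => leaf (bif c then z' else z) else leaf z

/-- The bits sent in `check` if the two players hold the bits `c` and `d`. -/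
def checkBits : Bool → Bool → Bool → List Bool
  | true, c, d => c :: bif c then [d] else []
  | false, c, d => d :: bif d then [c] else []

theorem bits_check (p : A → Bool) (q : B → Bool) (z' z : Z) (i : Bool) (a : A) (b : B) :
    (check p q z' z i).bits a b = checkBits i (p a) (q b) := by
  cases i <;> cases hp : p a <;> cases hq : q b <;> simp [check, checkBits, bits, hp, hq]

theorem output_check (p : A → Bool) (q : B → Bool) (z' z : Z) (i : Bool) (a : A) (b : B) :
    (check p q z' z i).output a b = bif p a && q b then z' else z := by
  cases i <;> cases hp : p a <;> cases hq : q b <;> simp [check, output, hp, hq]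

end ProtocolTree

/-! ### The protocol with a check appended -/

/-- The transcript after the players have checked whether their bits `c` and `d` are both `true`,
which they do if the transcript lies in `bad`; the player who begins is determined by `first`. -/
noncomputable def extendTranscript {R : Type*} (bad first : Set (R × List Bool)) (c d : Bool)
    (p : R × List Bool) : R × List Bool :=
  open Classical in
  (p.1, p.2 ++ if p ∈ bad then ProtocolTree.checkBits (decide (p ∈ first)) c d else [])

theorem measurable_extendTranscript {R : Type*} [MeasurableSpace R]
    {bad first : Set (R × List Bool)} (hbad : MeasurableSet bad) (hfirst : MeasurableSet first)
    (c d : Bool) : Measurable (extendTranscript bad first c d) := by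
  classical
  refine measurable_fst.prodMk ?_
  have h1 : Measurable fun p : R × List Bool => decide (p ∈ first) :=
    measurable_to_bool (by convert hfirst using 1; ext; simp)
  have h2 : Measurable fun p : R × List Bool =>
      if p ∈ bad then ProtocolTree.checkBits (decide (p ∈ first)) c d else [] :=
    Measurable.ite hbad
      ((measurable_of_countable fun i => ProtocolTree.checkBits i c d).comp h1) measurable_const
  exact (measurable_of_countable fun q : List Bool × List Bool => q.1 ++ q.2).comp
    (measurable_snd.prodMk h2)

/-- When Bob begins, Alice's bit is sent only after his `true`. It can thus be replaced by the event
that she actually sends `true`, which, unlike `c`, is rare. -/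
theorem extendTranscript_decide_left {R : Type*} (bad first : Set (R × List Bool)) (c d : Prop)
    [Decidable c] [Decidable d] (p : R × List Bool)
    [Decidable (p ∈ bad ∧ c ∧ (p ∈ first ∨ d))] :
    extendTranscript bad first (decide c) (decide d) p =
      extendTranscript bad first (decide (p ∈ bad ∧ c ∧ (p ∈ first ∨ d))) (decide d) p := by
  by_cases h1 : p ∈ bad <;> by_cases h2 : p ∈ first <;> by_cases h3 : d <;>
    simp [extendTranscript, h1, h2, h3, ProtocolTree.checkBits]

theorem extendTranscript_decide_right {R : Type*} (bad first : Set (R × List Bool)) (c d : Prop)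
    [Decidable c] [Decidable d] (p : R × List Bool)
    [Decidable (p ∈ bad ∧ d ∧ (p ∉ first ∨ c))] :
    extendTranscript bad first (decide c) (decide d) p =
      extendTranscript bad first (decide c) (decide (p ∈ bad ∧ d ∧ (p ∉ first ∨ c))) p := by
  by_cases h1 : p ∈ bad <;> by_cases h2 : p ∈ first <;> by_cases h3 : c <;>
    simp [extendTranscript, h1, h2, h3, ProtocolTree.checkBits]

namespace Protocol

variable {X : Type u} {Y : Type v} {Z : Type w}

theorem measurable_transcript (π : Protocol X Y Z) (x : X) (y : Y) :
    Measurable (π.transcript x y) :=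
  measurable_fst.prodMk (π.measurable_bits x y)

instance isProbabilityMeasure_coins (π : Protocol X Y Z) : IsProbabilityMeasure π.coins := by
  unfold coins; infer_instance

open Classical in
/-- Run `π`, and if the transcript lies in `bad` check whether the inputs are `a` and `b`; if so,
the output becomes `z'`. -/
noncomputable def verify (π : Protocol X Y Z) (a : X) (b : Y) (z' : Z)
    (bad first : Set (π.R × List Bool)) (hbad : MeasurableSet bad) (hfirst : MeasurableSet first) :
    Protocol X Y Z where
  R := π.R
  RA := π.RA
  RB := π.RB
  distR := π.distR
  distRA := π.distRA
  distRB := π.distRB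
  tree r := (π.tree r).extend fun t z =>
    if (r, t) ∈ bad then
      .check (fun p => decide (p.1 = a)) (fun q => decide (q.1 = b)) z' z (decide ((r, t) ∈ first))
    else .leaf z
  measurable_bits x y := by
    have := ((measurable_extendTranscript hbad hfirst (decide (x = a)) (decide (y = b))).comp
      (π.measurable_transcript x y)).snd
    convert this using 2 with ω
    rw [ProtocolTree.bits_extend]
    simp only [Function.comp, extendTranscript, transcript]
    by_cases hω : (ω.1, (π.tree ω.1).bits (x, ω.2.1) (y, ω.2.2)) ∈ bad
    · simp [hω, ProtocolTree.bits_check]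
      rfl
    · simp [hω, ProtocolTree.bits]
  measurable_output x y z := by
    have hB : MeasurableSet (π.transcript x y ⁻¹' bad) := π.measurable_transcript x y hbad
    have ho := π.measurable_output x y z
    have : {ω : π.R × π.RA × π.RB | ((π.tree ω.1).extend fun t z =>
        if (ω.1, t) ∈ bad then .check (fun p => decide (p.1 = a)) (fun q => decide (q.1 = b)) z' z
          (decide ((ω.1, t) ∈ first)) else .leaf z).output (x, ω.2.1) (y, ω.2.2) = z} =
        if x = a ∧ y = b then
          (π.transcript x y ⁻¹' bad ∩ {_ω | z' = z}) ∪ ((π.transcript x y ⁻¹' bad)ᶜ ∩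
            {ω | (π.tree ω.1).output (x, ω.2.1) (y, ω.2.2) = z})
        else {ω | (π.tree ω.1).output (x, ω.2.1) (y, ω.2.2) = z} := by
      ext ω
      rw [Set.mem_ofPred_eq, ProtocolTree.output_extend]
      by_cases hω : π.transcript x y ω ∈ bad
      · have hω' : (ω.1, (π.tree ω.1).bits (x, ω.2.1) (y, ω.2.2)) ∈ bad := hω
        rw [if_pos hω', ProtocolTree.output_check]
        by_cases hx : x = a <;> by_cases hy : y = b <;> simp [hx, hy]
        subst hx hy; simp [hω]
      · have hω' : (ω.1, (π.tree ω.1).bits (x, ω.2.1) (y, ω.2.2)) ∉ bad := hω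
        rw [if_neg hω', ProtocolTree.output]
        by_cases hx : x = a <;> by_cases hy : y = b <;> simp [hx, hy]
        subst hx hy; simp [hω]
    rw [this]
    split_ifs
    · exact (hB.inter (MeasurableSet.const _)).union (hB.compl.inter ho)
    · exact ho

section verify

variable (π : Protocol X Y Z) (a : X) (b : Y) (z' : Z) (bad first : Set (π.R × List Bool))
  (hbad : MeasurableSet bad) (hfirst : MeasurableSet first)

open Classical in
theorem transcript_verify (x : X) (y : Y) (ω : π.R × π.RA × π.RB) :
    (π.verify a b z' bad first hbad hfirst).transcript x y ω =
      extendTranscript bad first (decide (x = a)) (decide (y = b)) (π.transcript x y ω) := by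
  simp only [extendTranscript, transcript, verify, ProtocolTree.bits_extend]
  by_cases hω : (ω.1, (π.tree ω.1).bits (x, ω.2.1) (y, ω.2.2)) ∈ bad
  · simp [hω, ProtocolTree.bits_check]
    rfl
  · simp [hω, ProtocolTree.bits]

open Classical in
theorem output_verify (x : X) (y : Y) (ω : π.R × π.RA × π.RB) :
    (π.verify a b z' bad first hbad hfirst).output x y ω =
      if π.transcript x y ω ∈ bad ∧ x = a ∧ y = b then z' else π.output x y ω := by
  simp only [transcript, output, verify, ProtocolTree.output_extend]
  by_cases hx : x = a <;> by_cases hy : y = b <;> split_ifs <;>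
    simp_all [ProtocolTree.output_check, ProtocolTree.output]

end verify

end Protocol

/-! ### Transcript densities and the rectangle identity -/

namespace Protocol

variable {X : Type u} {Y : Type v} {Z : Type w}

/-- The reference measure on transcripts. -/
noncomputable def refMeasure (π : Protocol X Y Z) : Measure (π.R × List Bool) :=
  π.distR.prod Measure.count

/-- Alice's factor of the probability of the bits `p.2` given the public randomness `p.1`. -/
noncomputable def aliceWeight (π : Protocol X Y Z) (x : X) (p : π.R × List Bool) : ℝ≥0∞ :=
  π.distRA {u | (π.tree p.1).AliceAgrees p.2 (x, u)}

/-- Bob's factor of the probability of the bits `p.2` given the public randomness `p.1`. -/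
noncomputable def bobWeight (π : Protocol X Y Z) (y : Y) (p : π.R × List Bool) : ℝ≥0∞ :=
  π.distRB {v | (π.tree p.1).BobAgrees p.2 (y, v)}

/-- The probability of the bits `p.2` given the public randomness `p.1`. -/
noncomputable def weight (π : Protocol X Y Z) (x : X) (y : Y) (p : π.R × List Bool) : ℝ≥0∞ :=
  (π.distRA.prod π.distRB) {q | (π.tree p.1).bits (x, q.1) (y, q.2) = p.2}

/-- A fixed bit string cuts out a rectangle in the two private strings, which are independent. -/
theorem weight_eq_mul (π : Protocol X Y Z) (x : X) (y : Y) (p : π.R × List Bool) :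
    π.weight x y p = π.aliceWeight x p * π.bobWeight y p := by
  rw [weight, aliceWeight, bobWeight, ← Measure.prod_prod]
  congr 1
  ext q
  exact ProtocolTree.bits_eq_iff _ _ _ _

theorem measurable_weight (π : Protocol X Y Z) (x : X) (y : Y) : Measurable (π.weight x y) := by
  refine measurable_from_prod_countable_left fun t => ?_
  exact measurable_measure_prodMk_left (π.measurable_bits x y (measurableSet_singleton t))

theorem coins_transcript_mem (π : Protocol X Y Z) (x : X) (y : Y) {D : Set (π.R × List Bool)}
    (hD : MeasurableSet D) :
    π.coins {ω | π.transcript x y ω ∈ D} = ∫⁻ p in D, π.weight x y p ∂π.refMeasure := by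
  have hm : MeasurableSet {ω | π.transcript x y ω ∈ D} := π.measurable_transcript x y hD
  rw [coins, Measure.prod_apply hm, ← lintegral_indicator hD, refMeasure,
    lintegral_prod _ ((π.measurable_weight x y).indicator hD).aemeasurable]
  refine lintegral_congr fun r => ?_
  rw [lintegral_count]
  have hbits : Measurable fun q : π.RA × π.RB => (π.tree r).bits (x, q.1) (y, q.2) :=
    (π.measurable_bits x y).comp measurable_prodMk_left
  have hDr : MeasurableSet (Prod.mk r ⁻¹' D) := measurable_prodMk_left hD
  have := Measure.tsum_indicator_apply_singleton ((π.distRA.prod π.distRB).map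
    fun q => (π.tree r).bits (x, q.1) (y, q.2)) _ hDr
  rw [Measure.map_apply hbits hDr] at this
  refine this.symm.trans (tsum_congr fun t => ?_)
  by_cases ht : (r, t) ∈ D
  · have ht' : t ∈ Prod.mk r ⁻¹' D := ht
    rw [Set.indicator_of_mem ht, Set.indicator_of_mem ht',
      Measure.map_apply hbits (measurableSet_singleton t)]
    rfl
  · have ht' : t ∉ Prod.mk r ⁻¹' D := ht
    rw [Set.indicator_of_notMem ht, Set.indicator_of_notMem ht']

theorem lintegral_weight (π : Protocol X Y Z) (x : X) (y : Y) :
    ∫⁻ p, π.weight x y p ∂π.refMeasure = 1 := by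
  have := π.coins_transcript_mem x y MeasurableSet.univ
  rw [setLIntegral_univ] at this
  rw [← this]
  simp

/-- The transcripts that are almost surely not accompanied by the output `z` on the inputs
`x` and `y`. -/
def wrongSet (π : Protocol X Y Z) (x : X) (y : Y) (z : Z) : Set (π.R × List Bool) :=
  {p | (π.distRA.prod π.distRB) {q | (π.tree p.1).bits (x, q.1) (y, q.2) = p.2 ∧
    (π.tree p.1).output (x, q.1) (y, q.2) = z} = 0}

theorem measurableSet_wrongSet (π : Protocol X Y Z) (x : X) (y : Y) (z : Z) :
    MeasurableSet (π.wrongSet x y z) := by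
  have : Measurable fun p : π.R × List Bool =>
      (π.distRA.prod π.distRB) {q | (π.tree p.1).bits (x, q.1) (y, q.2) = p.2 ∧
        (π.tree p.1).output (x, q.1) (y, q.2) = z} := by
    refine measurable_from_prod_countable_left fun t => ?_
    exact measurable_measure_prodMk_left
      ((π.measurable_bits x y (measurableSet_singleton t)).inter (π.measurable_output x y z))
  exact this (measurableSet_singleton 0)

/-- This holds for every error, not just almost surely, because the output is a function of the
transcript. Defining `wrongSet` by null fibres makes it measurable. -/
theorem transcript_mem_wrongSet (π : Protocol X Y Z) {x : X} {y : Y} {z : Z}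
    {ω : π.R × π.RA × π.RB} (hω : π.output x y ω ≠ z) :
    π.transcript x y ω ∈ π.wrongSet x y z := by
  have : {q : π.RA × π.RB | (π.tree ω.1).bits (x, q.1) (y, q.2) =
      (π.tree ω.1).bits (x, ω.2.1) (y, ω.2.2) ∧
      (π.tree ω.1).output (x, q.1) (y, q.2) = z} = ∅ := by
    refine Set.eq_empty_of_forall_notMem fun q hq => hω ?_
    rw [← hq.2]
    exact ((π.tree ω.1).output_eq_of_bits_eq hq.1).symm
  change (π.distRA.prod π.distRB) {q : π.RA × π.RB | (π.tree ω.1).bits (x, q.1) (y, q.2) =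
      (π.tree ω.1).bits (x, ω.2.1) (y, ω.2.2) ∧
      (π.tree ω.1).output (x, q.1) (y, q.2) = z} = 0
  rw [this, measure_empty]

theorem coins_wrongSet_le (π : Protocol X Y Z) (x : X) (y : Y) (z : Z) :
    π.coins {ω | π.transcript x y ω ∈ π.wrongSet x y z} ≤ π.coins {ω | π.output x y ω ≠ z} := by
  set N := {ω : π.R × π.RA × π.RB | π.transcript x y ω ∈ π.wrongSet x y z ∧ π.output x y ω = z}
  -- For fixed public randomness there are countably many bit strings, and each contributes a null
  -- set by the definition of `wrongSet`.
  have hN : π.coins N = 0 := by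
    have hNm : MeasurableSet N :=
      (π.measurable_transcript x y (π.measurableSet_wrongSet x y z)).inter
        (π.measurable_output x y z)
    rw [coins, Measure.measure_prod_null hNm]
    refine .of_forall fun r => ?_
    have : Prod.mk r ⁻¹' N ⊆ ⋃ t ∈ {t | (r, t) ∈ π.wrongSet x y z},
        {q | (π.tree r).bits (x, q.1) (y, q.2) = t ∧
          (π.tree r).output (x, q.1) (y, q.2) = z} := by
      rintro q ⟨h1, h2⟩
      exact Set.mem_biUnion h1 ⟨rfl, h2⟩
    refine measure_mono_null this ((measure_biUnion_null_iff (Set.to_countable _)).2 ?_)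
    exact fun t ht => ht
  calc _ ≤ π.coins ({ω | π.output x y ω ≠ z} ∪ N) := by
        refine measure_mono fun ω hω => ?_
        by_cases h : π.output x y ω = z
        · exact Or.inr ⟨hω, h⟩
        · exact Or.inl h
    _ ≤ _ := by rw [← add_zero (π.coins {ω | π.output x y ω ≠ z}), ← hN]; exact measure_union_le _ _

/-- The density of the transcript on the event that Alice has the input `a`. -/
noncomputable def aliceDensity [Fintype Y] [MeasurableSpace X] [MeasurableSpace Y]
    (π : Protocol X Y Z) (μ : Measure (X × Y)) (a : X) (p : π.R × List Bool) : ℝ≥0∞ :=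
  ∑ y, μ {(a, y)} * π.weight a y p

/-- The density of the transcript on the event that Bob has the input `b`. -/
noncomputable def bobDensity [Fintype X] [MeasurableSpace X] [MeasurableSpace Y]
    (π : Protocol X Y Z) (μ : Measure (X × Y)) (b : Y) (p : π.R × List Bool) : ℝ≥0∞ :=
  ∑ x, μ {(x, b)} * π.weight x b p

theorem measurable_aliceDensity [Fintype Y] [MeasurableSpace X] [MeasurableSpace Y]
    (π : Protocol X Y Z) (μ : Measure (X × Y)) (a : X) : Measurable (π.aliceDensity μ a) :=
  Finset.measurable_fun_sum _ fun y _ => (π.measurable_weight a y).const_mul _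

theorem measurable_bobDensity [Fintype X] [MeasurableSpace X] [MeasurableSpace Y]
    (π : Protocol X Y Z) (μ : Measure (X × Y)) (b : Y) : Measurable (π.bobDensity μ b) :=
  Finset.measurable_fun_sum _ fun x _ => (π.measurable_weight x b).const_mul _

section flag

variable [Fintype X] [Fintype Y] [MeasurableSpace X] [MeasurableSpace Y] (π : Protocol X Y Z)
  (μ : Measure (X × Y))

/-- The density of the transcript if Alice's and Bob's inputs are independently distributed as
those on the events that Bob has the input `b` and that Alice has the input `a`, respectively. -/
noncomputable def crossDensity (a : X) (b : Y) (p : π.R × List Bool) : ℝ≥0∞ :=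
  ∑ y, ∑ x, μ {(a, y)} * μ {(x, b)} * π.weight x y p

/-- Corners of a rectangle can be exchanged: the weights at `(a, y)` and `(x, b)` have the same
product as those at `(a, b)` and `(x, y)`. -/
theorem aliceDensity_mul_bobDensity (a : X) (b : Y) (p : π.R × List Bool) :
    π.aliceDensity μ a p * π.bobDensity μ b p = π.weight a b p * π.crossDensity μ a b p := by
  rw [aliceDensity, bobDensity, crossDensity, Finset.sum_mul_sum]
  simp only [Finset.mul_sum, weight_eq_mul]
  refine Finset.sum_congr rfl fun y _ => Finset.sum_congr rfl fun x _ => ?_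
  ring

variable [DiscreteMeasurableSpace X] [DiscreteMeasurableSpace Y]

theorem measurable_inputs_transcript :
    Measurable fun ω : (X × Y) × (π.R × π.RA × π.RB) => π.transcript ω.1.1 ω.1.2 ω.2 :=
  measurable_from_prod_countable_right fun p => π.measurable_transcript p.1 p.2

theorem prod_coins_alice [IsProbabilityMeasure μ] (a : X) {D : Set (π.R × List Bool)}
    (hD : MeasurableSet D) :
    (μ.prod π.coins) {ω | π.transcript ω.1.1 ω.1.2 ω.2 ∈ D ∧ ω.1.1 = a} =
      ∫⁻ p in D, π.aliceDensity μ a p ∂π.refMeasure := by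
  have hm : MeasurableSet {ω : (X × Y) × (π.R × π.RA × π.RB) |
      π.transcript ω.1.1 ω.1.2 ω.2 ∈ D ∧ ω.1.1 = a} :=
    (π.measurable_inputs_transcript hD).inter
      ((measurable_fst.comp measurable_fst) (measurableSet_singleton a))
  rw [Measure.prod_apply hm, lintegral_fintype, Fintype.sum_prod_type, Finset.sum_eq_single a]
  · simp only [aliceDensity]
    rw [lintegral_finsetSum _ fun y _ => (π.measurable_weight a y).const_mul _]
    refine Finset.sum_congr rfl fun y _ => ?_
    rw [lintegral_const_mul _ (π.measurable_weight a y), ← π.coins_transcript_mem a y hD, mul_comm]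
    congr 2
    ext ω
    simp
  · intro x _ hx
    refine Finset.sum_eq_zero fun y _ => ?_
    have : Prod.mk (x, y) ⁻¹' {ω : (X × Y) × (π.R × π.RA × π.RB) |
        π.transcript ω.1.1 ω.1.2 ω.2 ∈ D ∧ ω.1.1 = a} = ∅ := by
      ext ω; simp [hx]
    rw [this, measure_empty, zero_mul]
  · simp

theorem prod_coins_bob [IsProbabilityMeasure μ] (b : Y) {D : Set (π.R × List Bool)}
    (hD : MeasurableSet D) :
    (μ.prod π.coins) {ω | π.transcript ω.1.1 ω.1.2 ω.2 ∈ D ∧ ω.1.2 = b} =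
      ∫⁻ p in D, π.bobDensity μ b p ∂π.refMeasure := by
  have hm : MeasurableSet {ω : (X × Y) × (π.R × π.RA × π.RB) |
      π.transcript ω.1.1 ω.1.2 ω.2 ∈ D ∧ ω.1.2 = b} :=
    (π.measurable_inputs_transcript hD).inter
      ((measurable_snd.comp measurable_fst) (measurableSet_singleton b))
  rw [Measure.prod_apply hm, lintegral_fintype, Fintype.sum_prod_type_right,
    Finset.sum_eq_single b]
  · simp only [bobDensity]
    rw [lintegral_finsetSum _ fun x _ => (π.measurable_weight x b).const_mul _]
    refine Finset.sum_congr rfl fun x _ => ?_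
    rw [lintegral_const_mul _ (π.measurable_weight x b), ← π.coins_transcript_mem x b hD, mul_comm]
    congr 2
    ext ω
    simp
  · intro y _ hy
    refine Finset.sum_eq_zero fun x _ => ?_
    have : Prod.mk (x, y) ⁻¹' {ω : (X × Y) × (π.R × π.RA × π.RB) |
        π.transcript ω.1.1 ω.1.2 ω.2 ∈ D ∧ ω.1.2 = b} = ∅ := by
      ext ω; simp [hy]
    rw [this, measure_empty, zero_mul]
  · simp

/-- Each weight integrates to 1, so the mass is the product of the probabilities of `a` and `b`. -/
theorem lintegral_crossDensity_le [IsProbabilityMeasure μ] (a : X) (b : Y) :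
    ∫⁻ p, π.crossDensity μ a b p ∂π.refMeasure ≤ 1 := by
  simp only [crossDensity]
  have hm : ∀ x y, Measurable fun p => μ {(a, y)} * μ {(x, b)} * π.weight x y p :=
    fun x y => (π.measurable_weight x y).const_mul _
  rw [lintegral_finsetSum _ fun y _ => Finset.measurable_fun_sum _ fun x _ => hm x y]
  simp_rw [lintegral_finsetSum _ fun x _ => hm x _,
    lintegral_const_mul _ (π.measurable_weight _ _), lintegral_weight, mul_one]
  rw [← Finset.sum_mul_sum]
  have h1 : ∑ y, μ {(a, y)} ≤ 1 := by
    rw [← measure_biUnion_finset (fun y _ y' _ h => by simpa [eq_comm] using h)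
      (fun y _ => measurableSet_singleton _)]
    exact prob_le_one
  have h2 : ∑ x, μ {(x, b)} ≤ 1 := by
    rw [← measure_biUnion_finset (fun y _ y' _ h => by simpa [eq_comm] using h)
      (fun y _ => measurableSet_singleton _)]
    exact prob_le_one
  exact mul_le_one' h1 h2

end flag

end Protocol

/-- AM-GM: `min A B` is at most the geometric mean of `P` and `C`. -/
theorem two_mul_mul_min_le {A B P C : ℝ≥0∞} (hP : P ≠ ⊤) (hC : C ≠ ⊤)
    (hAB : A * B = P * C) (s : ℝ≥0∞) (hs : s ≠ ⊤) :
    2 * s * min A B ≤ P + s ^ 2 * C := by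
  have hm2 : (min A B) ^ 2 ≤ P * C := by
    rw [← hAB, sq]; exact mul_le_mul' (min_le_left _ _) (min_le_right _ _)
  have hm : min A B ≠ ⊤ := by
    intro h
    rw [h] at hm2
    exact absurd hm2 (by simpa using (ENNReal.mul_lt_top hP.lt_top hC.lt_top).ne)
  generalize min A B = m at *
  lift m to NNReal using hm
  lift P to NNReal using hP
  lift C to NNReal using hC
  lift s to NNReal using hs
  norm_cast at *
  have hm2' : (m : ℝ) ^ 2 ≤ P * C := by exact_mod_cast hm2
  suffices (2 * s * m : ℝ) ≤ P + s ^ 2 * C by exact_mod_cast this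
  refine abs_le_of_sq_le_sq' ?_ (by positivity) |>.2
  nlinarith [sq_nonneg ((P : ℝ) - s ^ 2 * C), mul_le_mul_of_nonneg_left hm2' (sq_nonneg (s : ℝ))]

/-! ### Probability and information cost of the check -/

namespace Protocol

variable {X : Type u} {Y : Type v} {Z : Type w} [Fintype X] [Fintype Y]
  [MeasurableSpace X] [MeasurableSpace Y]

/-- The transcripts for which Alice's input is at most as likely to be `a` as Bob's is to be `b`. -/
def aliceFirstSet (π : Protocol X Y Z) (μ : Measure (X × Y)) (a : X) (b : Y) :
    Set (π.R × List Bool) :=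
  {p | π.aliceDensity μ a p ≤ π.bobDensity μ b p}

theorem measurableSet_aliceFirstSet (π : Protocol X Y Z) (μ : Measure (X × Y)) (a : X) (b : Y) :
    MeasurableSet (π.aliceFirstSet μ a b) :=
  measurableSet_le (π.measurable_aliceDensity μ a) (π.measurable_bobDensity μ b)

variable [DiscreteMeasurableSpace X] [DiscreteMeasurableSpace Y]

/-- Given the transcript of a protocol that rarely errs on the input `(a, b)`, a positive first
answer in the check for `(a, b)` is unlikely. -/
theorem prod_coins_check_le (π : Protocol X Y Z) (μ : Measure (X × Y)) [IsProbabilityMeasure μ]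
    (a : X) (b : Y) (z : Z) {s : ℝ} (hs : 0 < s)
    (herr : π.coins {ω | π.output a b ω ≠ z} ≤ ENNReal.ofReal s ^ 2) :
    (μ.prod π.coins) {ω | π.transcript ω.1.1 ω.1.2 ω.2 ∈ π.wrongSet a b z ∩ π.aliceFirstSet μ a b ∧
        ω.1.1 = a} +
      (μ.prod π.coins) {ω | π.transcript ω.1.1 ω.1.2 ω.2 ∈
        π.wrongSet a b z ∩ (π.aliceFirstSet μ a b)ᶜ ∧ ω.1.2 = b} ≤ ENNReal.ofReal s := by
  have hB := π.measurableSet_wrongSet a b z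
  have hF := π.measurableSet_aliceFirstSet μ a b
  have hAm := π.measurable_aliceDensity μ a
  have hBm := π.measurable_bobDensity μ b
  rw [π.prod_coins_alice μ a (hB.inter hF), π.prod_coins_bob μ b (hB.inter hF.compl)]
  -- The rule for who begins selects the smaller density pointwise.
  have hsum : ∫⁻ p in π.wrongSet a b z ∩ π.aliceFirstSet μ a b, π.aliceDensity μ a p ∂π.refMeasure +
      ∫⁻ p in π.wrongSet a b z ∩ (π.aliceFirstSet μ a b)ᶜ, π.bobDensity μ b p ∂π.refMeasure =
      ∫⁻ p in π.wrongSet a b z, min (π.aliceDensity μ a p) (π.bobDensity μ b p)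
        ∂π.refMeasure := by
    rw [← lintegral_inter_add_sdiff _ (π.wrongSet a b z) hF, Set.sdiff_eq]
    congr 1
    · exact setLIntegral_congr_fun (hB.inter hF) fun p hp => (min_eq_left hp.2).symm
    · exact setLIntegral_congr_fun (hB.inter hF.compl)
        fun p hp => (min_eq_right (le_of_not_ge fun hle => hp.2 hle)).symm
  rw [hsum]
  set t := ENNReal.ofReal s
  have ht : t ≠ ⊤ := ENNReal.ofReal_ne_top
  have ht0 : t ≠ 0 := by simpa [t] using hs
  have hw : ∀ x y p, π.weight x y p ≠ ⊤ := fun x y p => measure_ne_top _ _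
  have hpt : ∀ p, 2 * t * min (π.aliceDensity μ a p) (π.bobDensity μ b p) ≤
      π.weight a b p + t ^ 2 * π.crossDensity μ a b p := fun p =>
    two_mul_mul_min_le (hw _ _ _) (ENNReal.sum_ne_top.2 fun y _ => ENNReal.sum_ne_top.2 fun x _ =>
      ENNReal.mul_ne_top (ENNReal.mul_ne_top (measure_ne_top _ _) (measure_ne_top _ _)) (hw _ _ _))
      (π.aliceDensity_mul_bobDensity μ a b p) t ht
  have hmul : 2 * t * ∫⁻ p in π.wrongSet a b z,
      min (π.aliceDensity μ a p) (π.bobDensity μ b p) ∂π.refMeasure ≤ 2 * t * t := by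
    rw [← lintegral_const_mul _ (hAm.min hBm)]
    calc _ ≤ ∫⁻ p in π.wrongSet a b z, (π.weight a b p + t ^ 2 * π.crossDensity μ a b p)
            ∂π.refMeasure := lintegral_mono hpt
      _ = π.coins {ω | π.transcript a b ω ∈ π.wrongSet a b z} +
          t ^ 2 * ∫⁻ p in π.wrongSet a b z, π.crossDensity μ a b p ∂π.refMeasure := by
        rw [lintegral_add_left (π.measurable_weight a b), ← π.coins_transcript_mem a b hB,
          lintegral_const_mul' _ _ (ENNReal.pow_ne_top ht)]
      _ ≤ t ^ 2 + t ^ 2 * 1 := by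
        gcongr
        · exact (π.coins_wrongSet_le a b z).trans herr
        · exact (setLIntegral_le_lintegral _ _).trans (π.lintegral_crossDensity_le μ a b)
      _ = 2 * t * t := by ring
  exact (ENNReal.mul_le_mul_iff_right (mul_ne_zero two_ne_zero ht0)
    (ENNReal.mul_ne_top ENNReal.ofNat_ne_top ht)).1 hmul

variable (π : Protocol X Y Z) (μ : Measure (X × Y)) [IsProbabilityMeasure μ] (a : X) (b : Y)
  (z' : Z) (bad first : Set (π.R × List Bool))
  (hbad : MeasurableSet bad) (hfirst : MeasurableSet first)

/-- For `I(Π ; X | Y)` the added bit is "Alice sends `true`", for the other term "Bob sends `true`".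
Either event forces the first answer to be `true`, whose probability is the sum in `hp`. -/
theorem infoCost_verify_le {s : ℝ} (hs0 : 0 < s) (hs2 : s ≤ 1 / 2)
    (hp : (μ.prod π.coins) {ω | π.transcript ω.1.1 ω.1.2 ω.2 ∈ bad ∩ first ∧ ω.1.1 = a} +
      (μ.prod π.coins) {ω | π.transcript ω.1.1 ω.1.2 ω.2 ∈ bad ∩ firstᶜ ∧ ω.1.2 = b} ≤
        ENNReal.ofReal s ∨ s = 1 / 2) :
    (π.verify a b z' bad first hbad hfirst).infoCost μ ≤
      π.infoCost μ + 2 * ENNReal.ofReal (h s) := by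
  classical
  have hT := π.measurable_inputs_transcript
  have hT' := (π.verify a b z' bad first hbad hfirst).measurable_inputs_transcript
  have hX : Measurable fun ω : (X × Y) × (π.R × π.RA × π.RB) => ω.1.1 :=
    measurable_fst.comp measurable_fst
  have hY : Measurable fun ω : (X × Y) × (π.R × π.RA × π.RB) => ω.1.2 :=
    measurable_snd.comp measurable_fst
  have hunion : ∀ E : Set ((X × Y) × (π.R × π.RA × π.RB)),
      E ⊆ {ω | π.transcript ω.1.1 ω.1.2 ω.2 ∈ bad ∩ first ∧ ω.1.1 = a} ∪
        {ω | π.transcript ω.1.1 ω.1.2 ω.2 ∈ bad ∩ firstᶜ ∧ ω.1.2 = b} →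
      (μ.prod π.coins) E ≤ ENNReal.ofReal s ∨ s = 1 / 2 := fun E hE =>
    hp.imp_left fun hp => ((measure_mono hE).trans (measure_union_le _ _)).trans hp
  have hA := condMutualInfo_extend_le (μ.prod π.coins) hT hT' hX hY
    (φ := fun y q => decide (q.1 ∈ bad ∧ q.2 = a ∧ (q.1 ∈ first ∨ y = b)))
    (fun y => measurable_to_bool (by
      have : MeasurableSet ((Prod.fst ⁻¹' bad : Set ((π.R × List Bool) × X)) ∩
          (Prod.snd ⁻¹' {a} ∩ (Prod.fst ⁻¹' first ∪ {_q | y = b}))) :=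
        (measurable_fst hbad).inter ((measurable_snd (measurableSet_singleton a)).inter
          ((measurable_fst hfirst).union (MeasurableSet.const _)))
      convert this using 1
      ext q; simp))
    (Ψ := fun y q => extendTranscript bad first q.2 (decide (y = b)) q.1)
    (fun y => measurable_from_prod_countable_left fun c =>
      measurable_extendTranscript hbad hfirst c _)
    (fun ω => by
      rw [transcript_verify]
      exact extendTranscript_decide_left bad first _ _ _)
    hs0 hs2 (hunion _ fun ω hω => by
      simp only [Set.mem_ofPred_eq, decide_eq_true_eq] at hω
      simp only [Set.mem_union, Set.mem_ofPred_eq, Set.mem_inter_iff, Set.mem_compl_iff]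
      tauto)
  have hB := condMutualInfo_extend_le (μ.prod π.coins) hT hT' hY hX
    (φ := fun x q => decide (q.1 ∈ bad ∧ q.2 = b ∧ (q.1 ∉ first ∨ x = a)))
    (fun x => measurable_to_bool (by
      have : MeasurableSet ((Prod.fst ⁻¹' bad : Set ((π.R × List Bool) × Y)) ∩
          (Prod.snd ⁻¹' {b} ∩ (Prod.fst ⁻¹' firstᶜ ∪ {_q | x = a}))) :=
        (measurable_fst hbad).inter ((measurable_snd (measurableSet_singleton b)).inter
          ((measurable_fst hfirst.compl).union (MeasurableSet.const _)))
      convert this using 1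
      ext q; simp))
    (Ψ := fun x q => extendTranscript bad first (decide (x = a)) q.2 q.1)
    (fun x => measurable_from_prod_countable_left fun c =>
      measurable_extendTranscript hbad hfirst _ c)
    (fun ω => by
      rw [transcript_verify]
      exact extendTranscript_decide_right bad first _ _ _)
    hs0 hs2 (hunion _ fun ω hω => by
      simp only [Set.mem_ofPred_eq, decide_eq_true_eq] at hω
      simp only [Set.mem_union, Set.mem_ofPred_eq, Set.mem_inter_iff, Set.mem_compl_iff]
      tauto)
  refine (add_le_add hA hB).trans_eq ?_
  rw [infoCost, two_mul]
  abel

end Protocol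

/-! ### Repairing all inputs -/

/-- The errors of a protocol on the input `(a, b)` can be removed at a small cost. -/
theorem exists_protocol_correct_at {X : Type u} {Y : Type v} {Z : Type w} [Fintype X] [Fintype Y]
    [MeasurableSpace X] [DiscreteMeasurableSpace X] [MeasurableSpace Y] [DiscreteMeasurableSpace Y]
    (f : X → Y → Z) (μ : Measure (X × Y)) [IsProbabilityMeasure μ] {ε : ℝ} (hε : 0 < ε)
    (π : Protocol X Y Z) (hπ : π.Performs f ε) (a : X) (b : Y) :
    ∃ π' : Protocol X Y Z,
      (∀ x y, π'.coins {ω | π'.output x y ω ≠ f x y} ≤ π.coins {ω | π.output x y ω ≠ f x y}) ∧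
      π'.coins {ω | π'.output a b ω ≠ f a b} = 0 ∧
      π'.infoCost μ ≤ π.infoCost μ + 2 * ENNReal.ofReal (h (min (Real.sqrt ε) (1 / 2))) := by
  have hs : 0 < Real.sqrt ε := Real.sqrt_pos.2 hε
  refine ⟨π.verify a b (f a b) (π.wrongSet a b (f a b)) (π.aliceFirstSet μ a b)
    (π.measurableSet_wrongSet a b _) (π.measurableSet_aliceFirstSet μ a b), fun x y => ?_, ?_, ?_⟩
  · refine measure_mono fun ω hω => ?_
    have e := π.output_verify a b (f a b) _ _ (π.measurableSet_wrongSet a b (f a b))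
      (π.measurableSet_aliceFirstSet μ a b) x y ω
    split_ifs at e with hc
    · obtain ⟨-, rfl, rfl⟩ := hc
      exact absurd e hω
    · exact fun ho => hω (e.trans ho)
  · refine measure_mono_null (t := ∅) (fun ω hω => ?_) measure_empty
    have e := π.output_verify a b (f a b) _ _ (π.measurableSet_wrongSet a b (f a b))
      (π.measurableSet_aliceFirstSet μ a b) a b ω
    split_ifs at e with hc
    · exact hω e
    · exact hc ⟨π.transcript_mem_wrongSet fun ho => hω (e.trans ho), rfl, rfl⟩
  · refine π.infoCost_verify_le μ a b _ _ _ _ _ (lt_min hs (by norm_num)) (min_le_right _ _) ?_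
    -- Beyond `1 / 2` the trivial bound of one bit suffices, and the error probability plays no
    -- role.
    rcases le_total (Real.sqrt ε) (1 / 2) with hle | hle
    · refine Or.inl ?_
      rw [min_eq_left hle]
      refine π.prod_coins_check_le μ a b _ hs ?_
      rw [← ENNReal.ofReal_pow hs.le, Real.sq_sqrt hε.le]
      exact (ENNReal.le_ofReal_iff_toReal_le (measure_ne_top _ _) hε.le).2 (hπ a b)
    · exact Or.inr (min_eq_right hle)

theorem IC_zero_le {X : Type u} {Y : Type v} {Z : Type w} [Fintype X] [Fintype Y]
    [MeasurableSpace X] [DiscreteMeasurableSpace X] [MeasurableSpace Y] [DiscreteMeasurableSpace Y]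
    (f : X → Y → Z) (μ : Measure (X × Y)) [IsProbabilityMeasure μ] {ε : ℝ} (hε : 0 < ε) :
    IC μ f 0 ≤ IC μ f ε + 2 * (Fintype.card X : ℝ≥0∞) * (Fintype.card Y : ℝ≥0∞) *
      ENNReal.ofReal (h (min (Real.sqrt ε) (1 / 2))) := by
  classical
  set c := ENNReal.ofReal (h (min (Real.sqrt ε) (1 / 2)))
  -- Every intermediate protocol still performs `[f, ε]`, so each repair costs the same amount `2 *
  -- c`, and repaired inputs stay repaired.
  have main : ∀ π : Protocol X Y Z, π.Performs f ε → ∀ s : Finset (X × Y),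
      ∃ π' : Protocol X Y Z, π'.Performs f ε ∧
        (∀ p ∈ s, π'.coins {ω | π'.output p.1 p.2 ω ≠ f p.1 p.2} = 0) ∧
        π'.infoCost μ ≤ π.infoCost μ + s.card * (2 * c) := by
    intro π hπ s
    induction s using Finset.induction_on with
    | empty => exact ⟨π, hπ, by simp, by simp⟩
    | insert p s hp ih =>
      obtain ⟨π₁, h1, h2, h3⟩ := ih
      obtain ⟨π₂, k1, k2, k3⟩ := exists_protocol_correct_at f μ hε π₁ h1 p.1 p.2
      refine ⟨π₂, fun x y => ?_, fun q hq => ?_, ?_⟩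
      · exact (ENNReal.toReal_mono (measure_ne_top _ _) (k1 x y)).trans (h1 x y)
      · rcases Finset.mem_insert.1 hq with rfl | hq
        · exact k2
        · exact le_antisymm ((k1 _ _).trans_eq (h2 q hq)) bot_le
      · refine k3.trans ((add_le_add_left h3 _).trans_eq ?_)
        rw [Finset.card_insert_of_notMem hp]
        push_cast
        ring
  rw [IC, IC, ENNReal.iInf_add]
  refine le_iInf fun π => ?_
  rw [ENNReal.iInf_add]
  refine le_iInf fun hπ => ?_
  obtain ⟨π', -, h2, h3⟩ := main π hπ Finset.univ
  refine (iInf₂_le π' fun x y => ?_).trans (h3.trans_eq ?_)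
  · rw [measureReal_def, h2 (x, y) (Finset.mem_univ _)]
    simp
  · rw [Finset.card_univ, Fintype.card_prod]
    push_cast
    ring

/-! ### Finiteness -/

/-- The protocol without communication, with the output `z`. -/
noncomputable def constProtocol (X : Type u) (Y : Type v) {Z : Type w} (z : Z) :
    Protocol X Y Z where
  R := Unit
  RA := Unit
  RB := Unit
  distR := Measure.dirac ()
  distRA := Measure.dirac ()
  distRB := Measure.dirac ()
  tree _ := .leaf z
  measurable_bits _ _ := measurable_const
  measurable_output _ _ z' := MeasurableSet.const (z = z')

theorem infoCost_constProtocol {X : Type u} {Y : Type v} {Z : Type w} [Fintype X] [Fintype Y]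
    [MeasurableSpace X] [MeasurableSpace Y] (μ : Measure (X × Y)) [IsProbabilityMeasure μ] (z : Z) :
    (constProtocol X Y z).infoCost μ = 0 := by
  have hX : Measurable fun ω : (X × Y) × ((constProtocol X Y z).R × (constProtocol X Y z).RA ×
    (constProtocol X Y z).RB) => ω.1.1 := measurable_fst.comp measurable_fst
  have hY : Measurable fun ω : (X × Y) × ((constProtocol X Y z).R × (constProtocol X Y z).RA ×
    (constProtocol X Y z).RB) => ω.1.2 := measurable_snd.comp measurable_fst
  have h1 := condMutualInfo_const (μ.prod (constProtocol X Y z).coins) ((), ([] : List Bool)) hX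
    (W := fun ω => ω.1.2)
  have h2 := condMutualInfo_const (μ.prod (constProtocol X Y z).coins) ((), ([] : List Bool)) hY
    (W := fun ω => ω.1.1)
  exact (congrArg₂ (· + ·) h1 h2).trans (add_zero 0)

theorem IC_one_eq_zero {X : Type u} {Y : Type v} {Z : Type w} [Fintype X] [Fintype Y]
    [MeasurableSpace X] [MeasurableSpace Y] (f : X → Y → Z) (μ : Measure (X × Y))
    [IsProbabilityMeasure μ] : IC μ f 1 = 0 := by
  obtain ⟨⟨a, b⟩⟩ : Nonempty (X × Y) := μ.nonempty_of_neZero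
  have hπ : (constProtocol X Y (f a b)).Performs f 1 := fun x y => measureReal_le_one
  exact le_antisymm ((iInf₂_le (constProtocol X Y (f a b)) hπ).trans_eq (infoCost_constProtocol μ _)) bot_le

theorem IC_zero_ne_top {X : Type u} {Y : Type v} {Z : Type w} [Fintype X] [Fintype Y]
    [MeasurableSpace X] [DiscreteMeasurableSpace X] [MeasurableSpace Y] [DiscreteMeasurableSpace Y]
    (f : X → Y → Z) (μ : Measure (X × Y)) [IsProbabilityMeasure μ] : IC μ f 0 ≠ ⊤ := by
  -- At error 1 a constant protocol is allowed and costs nothing; repairing it costs a finite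
  -- amount.
  refine ne_top_of_le_ne_top ?_ (IC_zero_le f μ one_pos)
  rw [IC_one_eq_zero]
  finiteness

theorem IC_anti {X : Type u} {Y : Type v} {Z : Type w} [Fintype X] [Fintype Y]
    [MeasurableSpace X] [MeasurableSpace Y] (f : X → Y → Z) (μ : Measure (X × Y)) {ε δ : ℝ}
    (h : ε ≤ δ) : IC μ f δ ≤ IC μ f ε :=
  iInf_mono fun _ => iInf_mono' fun hπ => ⟨fun x y => (hπ x y).trans h, le_rfl⟩

theorem h_nonneg {p : ℝ} (hp0 : 0 ≤ p) (hp1 : p ≤ 1) : 0 ≤ h p :=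
  div_nonneg (Real.binEntropy_nonneg hp0 hp1) (Real.log_nonneg one_le_two)

end InfoComplexity

theorem mainTheorem2 {X Y Z : Type*} [Fintype X] [Fintype Y] [Finite Z]
    [MeasurableSpace X] [DiscreteMeasurableSpace X]
    [MeasurableSpace Y] [DiscreteMeasurableSpace Y]
    (f : X → Y → Z) (μ : Measure (X × Y)) [IsProbabilityMeasure μ] (ε : ℝ) (hε : 0 ≤ ε) :
    InfoComplexity.IC μ f ε ≠ ⊤ ∧ InfoComplexity.IC μ f 0 ≠ ⊤ ∧
      (InfoComplexity.IC μ f ε).toReal ≥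
        (InfoComplexity.IC μ f 0).toReal -
          4 * (Fintype.card X : ℝ) * (Fintype.card Y : ℝ) *
            InfoComplexity.h (min (Real.sqrt ε) (1 / 2)) := by
  have h0 := InfoComplexity.IC_zero_ne_top f μ
  have hne : InfoComplexity.IC μ f ε ≠ ⊤ := ne_top_of_le_ne_top h0 (InfoComplexity.IC_anti f μ hε)
  have hh : 0 ≤ InfoComplexity.h (min (Real.sqrt ε) (1 / 2)) :=
    InfoComplexity.h_nonneg (le_min (Real.sqrt_nonneg _) (by norm_num))
      ((min_le_right _ _).trans (by norm_num))
  refine ⟨hne, h0, ?_⟩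
  have hK : 0 ≤ (Fintype.card X : ℝ) * (Fintype.card Y : ℝ) *
      InfoComplexity.h (min (Real.sqrt ε) (1 / 2)) := by positivity
  -- `ε = 0` is separate because the Bernoulli reference must give `true` positive mass; there the
  -- subtracted term only needs to be nonnegative.
  rcases hε.eq_or_lt with rfl | hpos
  · linarith
  · have key := ENNReal.toReal_mono (by finiteness) (InfoComplexity.IC_zero_le f μ hpos)
    rw [ENNReal.toReal_add hne (by finiteness)] at key
    simp only [ENNReal.toReal_mul, ENNReal.toReal_ofNat, ENNReal.toReal_natCast,
      ENNReal.toReal_ofReal hh] at key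
    -- `key` has the factor 2; nonnegativity `hK` weakens it to 4.
    linarith
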